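/- Let $\mathbb{K}$ be a field of characteristic $0$, and let $\mathcal{H}_{\mathbf{G}}$ be the $\mathbb{K}$-vector space with basis the set $\mathbf{G}$ of isomorphism classes of finite simple graphs. It is a Hopf algebra for the product $m$ given by disjoint union of graphs (the unit is the empty graph) and the coproduct $$\Delta(G)=\sum_{I\subseteq V(G)} G_{\mid I}\otimes G_{\mid V(G)\setminus I},$$ where $G_{\mid I}$ is the subgraph of $G$ induced by $I$; its counit sends the empty graph to $1$ and every other graph to $0$. A partial orientation of a graph $G$ is a triple $H=(V(G),E(H),A(H))$, where $E(H)$ is a set of unordered pairs of distinct vertices (edges) and $A(H)$ is a set of ordered pairs of distinct vertices (arcs), such that for any two distinct vertices $x,y$ at most one of $\{x,y\}\in E(H)$, $(x,y)\in A(H)$, $(y,x)\in A(H)$ holds, and such that $E(G)=E(H)\cup\{\{x,y\}\mid (x,y)\in A(H)\}$. It is totally acyclic if there is no sequence $(x_0,\ldots,x_n)$ of vertices with $n\geq 2$ and $x_0=x_n$, such that for every $i\in\{1,\ldots,n\}$, $\{x_{i-1},x_i\}\in E(H)$ or $(x_{i-1},x_i)\in A(H)$, and such that $(x_{i-1},x_i)\in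 A(H)$ for at least one $i$. Let $\mathcal{PO}_{\mathrm{tac}}(G)$ be the set of totally acyclic partial orientations of $G$, let $\mathrm{gr}_0(H)=(V(G),E(H))$ be the graph of unoriented edges of $H$, and let $\mathrm{cc}(L)$ be the number of connected components of a graph $L$. Proposition. The antipode $S$ of $(\mathcal{H}_{\mathbf{G}},m,\Delta)$ is given, for every finite simple graph $G$, by $$S(G)=\sum_{H\in \mathcal{PO}_{\mathrm{tac}}(G)} (-1)^{\mathrm{cc}(\mathrm{gr}_0(H))}\,\mathrm{gr}_0(H).$$ -/

import Mathlib

open scoped TensorProduct SimpleGraph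

noncomputable section

/-! ### Isomorphism classes of finite simple graphs -/

/-- Isomorphism of finite simple graphs; every finite graph is isomorphic to one whose vertex set
is some `Fin n`. -/
instance finGraphSetoid : Setoid (Σ n : ℕ, SimpleGraph (Fin n)) where
  r A B := Nonempty (A.2 ≃g B.2)
  iseqv := ⟨fun _ => ⟨SimpleGraph.Iso.refl⟩, fun ⟨e⟩ => ⟨e.symm⟩, fun ⟨e⟩ ⟨f⟩ => ⟨e.trans f⟩⟩

/-- The set of isomorphism classes of finite simple graphs. -/
def GraphClass : Type := Quotient finGraphSetoid

namespace GraphClass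

/-- The isomorphism class of a finite graph. -/
def mk {V : Type*} [Finite V] (G : SimpleGraph V) : GraphClass :=
  Quotient.mk finGraphSetoid ⟨Nat.card V, G.map (Finite.equivFin V).toEmbedding⟩

theorem mk_eq_mk_iff {V W : Type*} [Finite V] [Finite W] {G : SimpleGraph V} {H : SimpleGraph W} :
    mk G = mk H ↔ Nonempty (G ≃g H) := by
  have eG := SimpleGraph.Iso.map (Finite.equivFin V) G
  have eH := SimpleGraph.Iso.map (Finite.equivFin W) H
  exact (Quotient.eq (r := finGraphSetoid)).trans
    ⟨fun ⟨e⟩ => ⟨(eG.trans e).trans eH.symm⟩, fun ⟨e⟩ => ⟨(eG.symm.trans e).trans eH⟩⟩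

theorem mk_eq {V W : Type*} [Finite V] [Finite W] {G : SimpleGraph V} {H : SimpleGraph W}
    (e : G ≃g H) : mk G = mk H := mk_eq_mk_iff.2 ⟨e⟩

theorem ind_mk {p : GraphClass → Prop}
    (h : ∀ (n : ℕ) (G : SimpleGraph (Fin n)), p (mk G)) (c : GraphClass) : p c := by
  induction c using Quotient.inductionOn with
  | h a =>
    have : (Quotient.mk finGraphSetoid a : GraphClass) = mk a.2 :=
      Quotient.sound ⟨SimpleGraph.Iso.map (Finite.equivFin _) a.2⟩
    rw [this]
    exact h a.1 a.2

/-- A function of finite graphs `Fin n` that is invariant under isomorphism descends to classes. -/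
def lift {α : Sort*} (f : ∀ n : ℕ, SimpleGraph (Fin n) → α)
    (hf : ∀ m n (G : SimpleGraph (Fin m)) (H : SimpleGraph (Fin n)), (G ≃g H) → f m G = f n H)
    (c : GraphClass) : α :=
  Quotient.lift (fun a : Σ n : ℕ, SimpleGraph (Fin n) => f a.1 a.2)
    (fun a b (h : Nonempty (a.2 ≃g b.2)) => h.elim (hf a.1 b.1 a.2 b.2)) c

/-- The product of two classes is the class of the disjoint union. -/
instance : Mul GraphClass where
  mul := Quotient.lift₂ (fun a b => mk (a.2 ⊕g b.2))
    (fun _ _ _ _ ⟨e⟩ ⟨f⟩ => mk_eq (SimpleGraph.Iso.sumCongr e f))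

/-- The unit is the class of the empty graph. -/
instance : One GraphClass where
  one := mk (⊥ : SimpleGraph Empty)

theorem mk_mul_mk {V W : Type*} [Finite V] [Finite W] (G : SimpleGraph V) (H : SimpleGraph W) :
    mk G * mk H = mk (G ⊕g H) :=
  mk_eq (SimpleGraph.Iso.sumCongr (SimpleGraph.Iso.map (Finite.equivFin V) G).symm
    (SimpleGraph.Iso.map (Finite.equivFin W) H).symm)

theorem one_eq {V : Type*} [Finite V] [IsEmpty V] (G : SimpleGraph V) : (1 : GraphClass) = mk G :=
  mk_eq ⟨Equiv.equivOfIsEmpty _ _, fun {a} => a.elim⟩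

protected theorem mul_comm' (a b : GraphClass) : a * b = b * a := by
  induction a using ind_mk with | h m G =>
  induction b using ind_mk with | h n H =>
  rw [mk_mul_mk, mk_mul_mk]
  exact mk_eq SimpleGraph.Iso.sumComm

protected theorem one_mul' (a : GraphClass) : 1 * a = a := by
  induction a using ind_mk with | h m G =>
  change mk _ * mk G = _
  rw [mk_mul_mk]
  refine mk_eq ⟨Equiv.emptySum Empty _, ?_⟩
  rintro (u | u) (v | v)
  · exact u.elim
  · exact u.elim
  · exact v.elim
  · simp

instance : CommMonoid GraphClass where
  mul_assoc a b c := by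
    induction a using ind_mk with | h m G =>
    induction b using ind_mk with | h n H =>
    induction c using ind_mk with | h k K =>
    rw [mk_mul_mk, mk_mul_mk, mk_mul_mk, mk_mul_mk]
    exact mk_eq SimpleGraph.Iso.sumAssoc
  one_mul := GraphClass.one_mul'
  mul_one a := by rw [GraphClass.mul_comm', GraphClass.one_mul']
  mul_comm := GraphClass.mul_comm'

theorem mk_eq_one_iff {V : Type*} [Finite V] (G : SimpleGraph V) : mk G = 1 ↔ IsEmpty V := by
  constructor
  · intro h
    obtain ⟨e⟩ := mk_eq_mk_iff.1 (h : mk G = mk (⊥ : SimpleGraph Empty))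
    exact e.toEquiv.isEmpty
  · intro h
    exact (one_eq G).symm

end GraphClass

/-! ### The bialgebra of graphs -/

/-- The vector space with basis the isomorphism classes of finite graphs, with the product
extending the disjoint union. -/
def GraphAlgebra (K : Type*) [CommRing K] : Type _ := MonoidAlgebra K GraphClass

namespace GraphAlgebra

variable (K : Type*) [CommRing K]

instance : CommRing (GraphAlgebra K) := inferInstanceAs (CommRing (MonoidAlgebra K GraphClass))

instance : Algebra K (GraphAlgebra K) :=
  inferInstanceAs (Algebra K (MonoidAlgebra K GraphClass))

/-- The basis element attached to an isomorphism class. -/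
def of : GraphClass →* GraphAlgebra K := MonoidAlgebra.of K GraphClass

/-- The basis element attached to a finite graph. -/
def ofGraph {V : Type*} [Finite V] (G : SimpleGraph V) : GraphAlgebra K := of K (GraphClass.mk G)

theorem ofGraph_congr {V W : Type*} [Finite V] [Finite W] {G : SimpleGraph V} {H : SimpleGraph W}
    (e : G ≃g H) : ofGraph K G = ofGraph K H := by
  unfold ofGraph
  rw [GraphClass.mk_eq e]

theorem ofGraph_mul {V W : Type*} [Finite V] [Finite W] (G : SimpleGraph V) (H : SimpleGraph W) :
    ofGraph K G * ofGraph K H = ofGraph K (G ⊕g H) := by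
  unfold ofGraph
  rw [← map_mul, GraphClass.mk_mul_mk]

theorem ofGraph_of_isEmpty {V : Type*} [Finite V] [IsEmpty V] (G : SimpleGraph V) :
    ofGraph K G = 1 := by
  unfold ofGraph
  rw [(GraphClass.mk_eq_one_iff G).2 inferInstance, map_one]

variable {K}

/-- An algebra map out of `GraphAlgebra K` is a multiplicative map on classes. -/
def liftAlgHom {B : Type*} [Semiring B] [Algebra K B] (f : GraphClass →* B) :
    GraphAlgebra K →ₐ[K] B := MonoidAlgebra.lift K B GraphClass f

theorem liftAlgHom_ofGraph {B : Type*} [Semiring B] [Algebra K B] (f : GraphClass →* B)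
    {V : Type*} [Finite V] (G : SimpleGraph V) :
    liftAlgHom (K := K) f (ofGraph K G) = f (GraphClass.mk G) :=
  MonoidAlgebra.lift_of _ _

theorem linearMap_ext {B : Type*} [AddCommMonoid B] [Module K B] {f g : GraphAlgebra K →ₗ[K] B}
    (h : ∀ (n : ℕ) (G : SimpleGraph (Fin n)), f (ofGraph K G) = g (ofGraph K G)) : f = g := by
  refine MonoidAlgebra.lhom_ext' (fun c => ?_)
  induction c using GraphClass.ind_mk with | h n G =>
  ext
  exact h n G

theorem algHom_ext {B : Type*} [Semiring B] [Algebra K B] {f g : GraphAlgebra K →ₐ[K] B}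
    (h : ∀ (n : ℕ) (G : SimpleGraph (Fin n)), f (ofGraph K G) = g (ofGraph K G)) : f = g :=
  AlgHom.toLinearMap_injective (linearMap_ext h)

variable (K)

open Classical in
/-- `∑ G|I ⊗ G|(V ∖ I)` over all subsets `I` of the vertex set of `G`. -/
def comulGraph {V : Type*} [Fintype V] (G : SimpleGraph V) :
    GraphAlgebra K ⊗[K] GraphAlgebra K :=
  ∑ I : Set V, ofGraph K (G.induce I) ⊗ₜ[K] ofGraph K (G.induce Iᶜ)

/-- An isomorphism restricts to induced subgraphs. -/
def induceIso {V W : Type*} {G : SimpleGraph V} {H : SimpleGraph W} (e : G ≃g H) (I : Set V)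
    (J : Set W) (h : ∀ v, v ∈ I ↔ e v ∈ J) : G.induce I ≃g H.induce J where
  toEquiv := e.toEquiv.subtypeEquiv h
  map_rel_iff' := e.map_rel_iff'

theorem comulGraph_congr {V W : Type*} [Fintype V] [Fintype W] {G : SimpleGraph V}
    {H : SimpleGraph W} (e : G ≃g H) : comulGraph K G = comulGraph K H := by
  classical
  unfold comulGraph
  refine Fintype.sum_equiv (Equiv.Set.congr e.toEquiv) _ _ (fun I => ?_)
  congr 1
  · exact ofGraph_congr K (induceIso e _ _ (by intro v; simp [Equiv.Set.congr]))
  · exact ofGraph_congr K (induceIso e _ _ (by intro v; simp [Equiv.Set.congr]))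

/-- A subset of a disjoint union is a pair of subsets. -/
def setSumEquiv (V W : Type*) : Set (V ⊕ W) ≃ Set V × Set W where
  toFun I := (Sum.inl ⁻¹' I, Sum.inr ⁻¹' I)
  invFun P := {x | Sum.elim (· ∈ P.1) (· ∈ P.2) x}
  left_inv I := by ext (x | x) <;> simp
  right_inv P := by ext <;> simp

/-- An induced subgraph of a disjoint union is a disjoint union of induced subgraphs. -/
def induceSumIso {V W : Type*} (G : SimpleGraph V) (H : SimpleGraph W) (I : Set (V ⊕ W)) :
    (G ⊕g H).induce I ≃g G.induce (Sum.inl ⁻¹' I) ⊕g H.induce (Sum.inr ⁻¹' I) where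
  toFun x := match x with
    | ⟨Sum.inl v, h⟩ => Sum.inl ⟨v, h⟩
    | ⟨Sum.inr w, h⟩ => Sum.inr ⟨w, h⟩
  invFun x := match x with
    | Sum.inl v => ⟨Sum.inl v.1, v.2⟩
    | Sum.inr w => ⟨Sum.inr w.1, w.2⟩
  left_inv := by rintro ⟨v | w, h⟩ <;> rfl
  right_inv := by rintro (v | w) <;> rfl
  map_rel_iff' := by rintro ⟨v | w, h⟩ ⟨v' | w', h'⟩ <;> simp

theorem comulGraph_sum {V W : Type*} [Fintype V] [Fintype W] (G : SimpleGraph V)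
    (H : SimpleGraph W) : comulGraph K (G ⊕g H) = comulGraph K G * comulGraph K H := by
  classical
  unfold comulGraph
  rw [Finset.sum_mul_sum, ← Finset.sum_product', Finset.univ_product_univ]
  refine Fintype.sum_equiv (setSumEquiv V W) _ _ (fun I => ?_)
  rw [Algebra.TensorProduct.tmul_mul_tmul, ofGraph_mul, ofGraph_mul]
  congr 1
  · exact ofGraph_congr K (induceSumIso G H I)
  · exact ofGraph_congr K (induceSumIso G H Iᶜ)

theorem comulGraph_of_isEmpty {V : Type*} [Fintype V] [IsEmpty V] (G : SimpleGraph V) :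
    comulGraph K G = 1 := by
  classical
  unfold comulGraph
  rw [Fintype.sum_unique, ofGraph_of_isEmpty, ofGraph_of_isEmpty,
    Algebra.TensorProduct.one_def]

/-- The coproduct on isomorphism classes. -/
def comulClass (c : GraphClass) : GraphAlgebra K ⊗[K] GraphAlgebra K :=
  c.lift (fun _ G => comulGraph K G) (fun _ _ _ _ e => comulGraph_congr K e)

theorem comulClass_mk {V : Type*} [Fintype V] (G : SimpleGraph V) :
    comulClass K (GraphClass.mk G) = comulGraph K G :=
  comulGraph_congr K (SimpleGraph.Iso.map (Finite.equivFin V) G).symm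

/-- The coproduct `Δ(G) = ∑ G|I ⊗ G|(V ∖ I)`, as an algebra map. -/
def comulAlgHom : GraphAlgebra K →ₐ[K] GraphAlgebra K ⊗[K] GraphAlgebra K :=
  liftAlgHom
    { toFun := comulClass K
      map_one' := (comulClass_mk K _).trans (comulGraph_of_isEmpty K (⊥ : SimpleGraph Empty))
      map_mul' := fun a b => by
        induction a using GraphClass.ind_mk with | h m G =>
        induction b using GraphClass.ind_mk with | h n H =>
        rw [GraphClass.mk_mul_mk, comulClass_mk, comulClass_mk, comulClass_mk, comulGraph_sum] }

theorem comulAlgHom_ofGraph {V : Type*} [Fintype V] (G : SimpleGraph V) :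
    comulAlgHom K (ofGraph K G) = comulGraph K G :=
  (liftAlgHom_ofGraph _ G).trans (comulClass_mk K G)

open Classical in
/-- The counit `ε(G) = 1` if `G` is the empty graph and `0` otherwise, as an algebra map. -/
def counitAlgHom : GraphAlgebra K →ₐ[K] K :=
  liftAlgHom
    { toFun := fun c => if c = 1 then 1 else 0
      map_one' := if_pos rfl
      map_mul' := fun a b => by
        induction a using GraphClass.ind_mk with | h m G =>
        induction b using GraphClass.ind_mk with | h n H =>
        simp only [GraphClass.mk_mul_mk, GraphClass.mk_eq_one_iff, isEmpty_sum, ite_and]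
        split_ifs <;> simp }

open Classical in
theorem counitAlgHom_ofGraph {V : Type*} [Finite V] (G : SimpleGraph V) :
    counitAlgHom K (ofGraph K G) = if IsEmpty V then 1 else 0 := by
  rw [← GraphClass.mk_eq_one_iff G]
  exact liftAlgHom_ofGraph _ G

/-- An induced subgraph of an induced subgraph is an induced subgraph. -/
def induceInduceIso {V : Type*} (G : SimpleGraph V) (I : Set V) (J : Set I) :
    (G.induce I).induce J ≃g G.induce (Subtype.val '' J) where
  toFun x := ⟨x.1.1, x.1, x.2, rfl⟩
  invFun x := ⟨⟨x.1, by obtain ⟨x, y, hy, rfl⟩ := x; exact y.2⟩,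
    by obtain ⟨x, y, hy, rfl⟩ := x; exact hy⟩
  left_inv _ := rfl
  right_inv _ := rfl
  map_rel_iff' := Iff.rfl

open Classical in
theorem sum_set_subtype {V M : Type*} [Fintype V] [AddCommMonoid M] (I : Set V)
    (f : Set V → Set V → M) :
    ∑ J : Set I, f (Subtype.val '' J) (Subtype.val '' Jᶜ) =
      ∑ J : Set V with J ⊆ I, f J (I \ J) := by
  refine Finset.sum_bij' (fun J _ => Subtype.val '' J) (fun J _ => Subtype.val ⁻¹' J) ?_ ?_ ?_ ?_ ?_
  · intro J _
    simp
  · simp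
  · intro J _
    simp
  · intro J hJ
    simp at hJ
    simpa using hJ
  · intro J _
    congr 1
    ext x
    simp

open Classical in
theorem comulGraph_induce {V : Type*} [Fintype V] (G : SimpleGraph V) (I : Set V) [Fintype I] :
    comulGraph K (G.induce I) = ∑ J : Set V with J ⊆ I,
      ofGraph K (G.induce J) ⊗ₜ[K] ofGraph K (G.induce (I \ J)) := by
  rw [← sum_set_subtype I
    (fun A B => ofGraph K (G.induce A) ⊗ₜ[K] ofGraph K (G.induce B))]
  unfold comulGraph
  refine Finset.sum_congr (by congr!) (fun J _ => ?_)
  rw [ofGraph_congr K (induceInduceIso G I J), ofGraph_congr K (induceInduceIso G I Jᶜ)]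

open Classical in
theorem sum_sub_sub {V M : Type*} [Fintype V] [AddCommMonoid M] (f : Set V → Set V → Set V → M) :
    ∑ I : Set V, ∑ J : Set V with J ⊆ I, f J (I \ J) Iᶜ =
      ∑ I : Set V, ∑ J : Set V with J ⊆ Iᶜ, f I J (Iᶜ \ J) := by
  rw [Finset.sum_sigma', Finset.sum_sigma']
  refine Finset.sum_bij' (fun x _ => ⟨x.2, x.1 \ x.2⟩) (fun x _ => ⟨x.1 ∪ x.2, x.1⟩) ?_ ?_ ?_ ?_ ?_
  · rintro ⟨I, J⟩ h
    simp only [Finset.mem_sigma, Finset.mem_univ, Finset.mem_filter, true_and] at h ⊢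
    exact fun x hx => hx.2
  · rintro ⟨I, J⟩ h
    simp
  · rintro ⟨I, J⟩ h
    simp only [Finset.mem_sigma, Finset.mem_univ, Finset.mem_filter, true_and] at h
    simp [h]
  · rintro ⟨I, J⟩ h
    simp only [Finset.mem_sigma, Finset.mem_univ, Finset.mem_filter, true_and] at h
    simp only [Sigma.mk.injEq, heq_eq_eq, true_and]
    ext x
    have := @h x
    simp at this ⊢
    tauto
  · rintro ⟨I, J⟩ h
    simp only [Finset.mem_sigma, Finset.mem_univ, Finset.mem_filter, true_and] at h
    have : Iᶜ = Jᶜ \ (I \ J) := by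
      ext x
      have := @h x
      simp
      tauto
    simp only [← this]

/-- The bialgebra of graphs: product by disjoint union, coproduct by splitting the vertex set. -/
instance : Bialgebra K (GraphAlgebra K) :=
  Bialgebra.ofAlgHom (comulAlgHom K) (counitAlgHom K)
    (algHom_ext fun n G => by
      classical
      have h := sum_sub_sub (fun A B C : Set (Fin n) => ofGraph K (G.induce A) ⊗ₜ[K]
        (ofGraph K (G.induce B) ⊗ₜ[K] ofGraph K (G.induce C)))
      simp only [AlgHom.comp_apply, comulAlgHom_ofGraph]
      conv_lhs => rw [comulGraph]
      conv_rhs => rw [comulGraph]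
      simp only [map_sum, Algebra.TensorProduct.map_tmul, comulAlgHom_ofGraph, comulGraph_induce,
        TensorProduct.sum_tmul, TensorProduct.tmul_sum, AlgHom.coe_id, id_eq]
      refine Eq.trans (Finset.sum_congr rfl fun I _ => Finset.sum_congr rfl fun J _ => ?_) h
      rfl)
    (algHom_ext fun n G => by
      classical
      simp only [AlgHom.comp_apply, comulAlgHom_ofGraph, comulGraph, map_sum,
        Algebra.TensorProduct.map_tmul, counitAlgHom_ofGraph]
      rw [Finset.sum_eq_single (∅ : Set (Fin n))]
      · rw [if_pos (by simp)]
        have h : ofGraph K (G.induce (∅ : Set (Fin n))ᶜ) = ofGraph K G :=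
          ofGraph_congr K ((induceIso SimpleGraph.Iso.refl _ Set.univ (by simp)).trans
            (SimpleGraph.induceUnivIso G))
        simp [h]
      · intro I _ hI
        rw [if_neg (by simpa [Set.isEmpty_coe_sort] using hI), TensorProduct.zero_tmul]
      · simp)
    (algHom_ext fun n G => by
      classical
      simp only [AlgHom.comp_apply, comulAlgHom_ofGraph, comulGraph, map_sum,
        Algebra.TensorProduct.map_tmul, counitAlgHom_ofGraph]
      rw [Finset.sum_eq_single (Set.univ : Set (Fin n))]
      · rw [if_pos (by simp)]
        simp [ofGraph_congr K (SimpleGraph.induceUnivIso G)]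
      · intro I _ hI
        rw [if_neg (by simpa [Set.isEmpty_coe_sort] using hI), TensorProduct.tmul_zero]
      · simp)

theorem comul_ofGraph {V : Type*} [Fintype V] (G : SimpleGraph V) :
    Coalgebra.comul (R := K) (ofGraph K G) =
      ∑ I : Set V, ofGraph K (G.induce I) ⊗ₜ[K] ofGraph K (G.induce Iᶜ) := by
  refine (comulAlgHom_ofGraph K G).trans ?_
  unfold comulGraph
  congr!

open Classical in
theorem counit_ofGraph {V : Type*} [Finite V] (G : SimpleGraph V) :
    Coalgebra.counit (R := K) (ofGraph K G) = if IsEmpty V then 1 else 0 :=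
  counitAlgHom_ofGraph K G

/-! ### The antipode -/

open WithConv

/-- Linear endomorphisms with the convolution product. -/
abbrev ConvEnd : Type _ := WithConv (GraphAlgebra K →ₗ[K] GraphAlgebra K)

/-- `η ∘ ε - Id` as an element of the convolution algebra. -/
def unitSubId : ConvEnd K := 1 - toConv LinearMap.id

theorem unitSubId_of_isEmpty {V : Type*} [Finite V] [IsEmpty V] (G : SimpleGraph V) :
    unitSubId K (ofGraph K G) = 0 := by
  rw [ofGraph_of_isEmpty]
  change algebraMap K _ (Coalgebra.counit (R := K) (1 : GraphAlgebra K)) - (1 : GraphAlgebra K) = 0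
  simp

theorem unitSubId_pow_eq_zero (k : ℕ) {V : Type} [Fintype V] (G : SimpleGraph V)
    (h : Nat.card V < k) : (unitSubId K ^ k) (ofGraph K G) = 0 := by
  classical
  induction k generalizing V with
  | zero => omega
  | succ k ih =>
    rw [pow_succ', LinearMap.convMul_apply, comul_ofGraph, map_sum, map_sum]
    refine Finset.sum_eq_zero (fun I _ => ?_)
    rw [TensorProduct.map_tmul, LinearMap.mul'_apply]
    by_cases hI : IsEmpty I
    · have := unitSubId_of_isEmpty K (G.induce I)
      exact (congrArg (· * _) this).trans (zero_mul _)
    · have hc : Nat.card (Iᶜ : Set V) < k := by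
        have h1 : (Iᶜ : Set V).ncard + I.ncard = Nat.card V := by
          rw [add_comm]; exact Set.ncard_add_ncard_compl I
        have h2 : 0 < I.ncard := by
          rw [Set.ncard_pos]
          exact Set.nonempty_coe_sort.1 (not_isEmpty_iff.1 hI)
        have h3 : Nat.card (Iᶜ : Set V) = (Iᶜ : Set V).ncard := rfl
        omega
      exact (congrArg (_ * ·) (ih (G.induce Iᶜ) hc)).trans (mul_zero _)

/-- The partial sum `∑_{k < N} (η ∘ ε - Id)^{*k}` of the geometric series for the convolution
inverse of the identity. -/
def geomSum (N : ℕ) : ConvEnd K :=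
  ∑ k ∈ Finset.range N, unitSubId K ^ k

theorem geomSum_succ_apply {N : ℕ} {V : Type} [Fintype V] (G : SimpleGraph V)
    (h : Nat.card V < N) : geomSum K (N + 1) (ofGraph K G) = geomSum K N (ofGraph K G) := by
  have h1 : geomSum K (N + 1) = geomSum K N + unitSubId K ^ N := Finset.sum_range_succ _ _
  rw [h1]
  exact (congrArg (_ + ·) (unitSubId_pow_eq_zero K N G h)).trans (add_zero _)

theorem geomSum_apply_eq {M N : ℕ} (hMN : M ≤ N) {V : Type} [Fintype V] (G : SimpleGraph V)
    (h : Nat.card V < M) : geomSum K N (ofGraph K G) = geomSum K M (ofGraph K G) := by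
  induction N, hMN using Nat.le_induction with
  | base => rfl
  | succ N hN ih => rw [geomSum_succ_apply K G (by omega), ih]

/-- The value of the antipode on an isomorphism class: the stable value of the geometric series. -/
def antipodeClass (c : GraphClass) : GraphAlgebra K :=
  c.lift (fun n G => geomSum K (n + 1) (ofGraph K G)) (fun m n G H e => by
    obtain rfl : m = n := by simpa using Fintype.card_congr e.toEquiv
    rw [ofGraph_congr K e])

/-- The convolution inverse of the identity. -/
def antipodeMap : GraphAlgebra K →ₗ[K] GraphAlgebra K :=
  (MonoidAlgebra.basis GraphClass K).constr K (antipodeClass K)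

theorem antipodeMap_ofGraph {N : ℕ} {V : Type} [Fintype V] (G : SimpleGraph V)
    (h : Nat.card V < N) : antipodeMap K (ofGraph K G) = geomSum K N (ofGraph K G) := by
  have h1 : antipodeMap K (ofGraph K G) = antipodeClass K (GraphClass.mk G) := by
    have := (MonoidAlgebra.basis GraphClass K).constr_basis K (antipodeClass K) (GraphClass.mk G)
    rw [MonoidAlgebra.basis_apply] at this
    exact this
  have h2 : antipodeClass K (GraphClass.mk G) = geomSum K (Nat.card V + 1)
      (ofGraph K (G.map (Finite.equivFin V).toEmbedding)) := rfl
  have h3 : ofGraph K (G.map (Finite.equivFin V).toEmbedding) = ofGraph K G :=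
    ofGraph_congr K (SimpleGraph.Iso.map (Finite.equivFin V) G).symm
  rw [h1, h2, h3]
  exact (geomSum_apply_eq K (by omega) G (by omega)).symm

theorem one_sub_unitSubId : 1 - unitSubId K = toConv LinearMap.id := by
  unfold unitSubId
  abel

theorem geomSum_mul_apply {N : ℕ} {V : Type} [Fintype V] (G : SimpleGraph V)
    (h : Nat.card V < N) : (geomSum K N * toConv LinearMap.id : ConvEnd K) (ofGraph K G) =
      (1 : ConvEnd K) (ofGraph K G) := by
  have h1 : geomSum K N * toConv LinearMap.id = 1 - unitSubId K ^ N := by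
    rw [← one_sub_unitSubId]
    exact geom_sum_mul_neg (unitSubId K) N
  rw [h1]
  exact (congrArg (_ - ·) (unitSubId_pow_eq_zero K N G h)).trans (sub_zero _)

theorem mul_geomSum_apply {N : ℕ} {V : Type} [Fintype V] (G : SimpleGraph V)
    (h : Nat.card V < N) : (toConv LinearMap.id * geomSum K N : ConvEnd K) (ofGraph K G) =
      (1 : ConvEnd K) (ofGraph K G) := by
  have h1 : toConv LinearMap.id * geomSum K N = 1 - unitSubId K ^ N := by
    rw [← one_sub_unitSubId]
    exact mul_neg_geom_sum (unitSubId K) N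
  rw [h1]
  exact (congrArg (_ - ·) (unitSubId_pow_eq_zero K N G h)).trans (sub_zero _)

theorem card_set_lt {n : ℕ} (I : Set (Fin n)) : Nat.card I < n + 1 := by
  have := Nat.card_le_card_of_injective (Subtype.val : I → Fin n) Subtype.val_injective
  rw [Nat.card_fin] at this
  exact Nat.lt_succ_of_le this

theorem antipodeMap_mul_id : toConv (antipodeMap K) * toConv LinearMap.id = 1 := by
  classical
  refine WithConv.ext (linearMap_ext fun n G => ?_)
  refine Eq.trans ?_ (geomSum_mul_apply K (N := n + 1) G (by simp))
  change (toConv (antipodeMap K) * toConv LinearMap.id : ConvEnd K) (ofGraph K G) = _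
  rw [LinearMap.convMul_apply, LinearMap.convMul_apply, comul_ofGraph]
  simp only [map_sum, TensorProduct.map_tmul, LinearMap.mul'_apply]
  refine Finset.sum_congr rfl fun I _ => ?_
  exact congrArg (· * _) (antipodeMap_ofGraph K (G.induce I) (card_set_lt I))

theorem id_mul_antipodeMap : toConv LinearMap.id * toConv (antipodeMap K) = 1 := by
  classical
  refine WithConv.ext (linearMap_ext fun n G => ?_)
  refine Eq.trans ?_ (mul_geomSum_apply K (N := n + 1) G (by simp))
  change (toConv LinearMap.id * toConv (antipodeMap K) : ConvEnd K) (ofGraph K G) = _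
  rw [LinearMap.convMul_apply, LinearMap.convMul_apply, comul_ofGraph]
  simp only [map_sum, TensorProduct.map_tmul, LinearMap.mul'_apply]
  refine Finset.sum_congr rfl fun I _ => ?_
  exact congrArg (_ * ·) (antipodeMap_ofGraph K (G.induce Iᶜ) (card_set_lt Iᶜ))

/-- The Hopf algebra of graphs; its antipode is the (unique) convolution inverse of the
identity. -/
instance : HopfAlgebra K (GraphAlgebra K) :=
  HopfAlgebra.ofConvInverse (antipodeMap K) (antipodeMap_mul_id K) (id_mul_antipodeMap K)

end GraphAlgebra

/-! ### Mixed graphs and partial orientations -/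

/-- A mixed graph with vertex set `V`: a simple graph of edges and a set of arcs, that is ordered
pairs of distinct vertices, such that two distinct vertices are joined by at most one edge or
arc. -/
@[ext]
structure MixedGraph (V : Type*) where
  /-- The unoriented edges. -/
  edges : SimpleGraph V
  /-- The arcs. -/
  arcs : Set (V × V)
  arcs_ne : ∀ x y, (x, y) ∈ arcs → x ≠ y
  arcs_asymm : ∀ x y, (x, y) ∈ arcs → (y, x) ∉ arcs
  edges_disjoint : ∀ x y, edges.Adj x y → (x, y) ∉ arcs ∧ (y, x) ∉ arcs

namespace MixedGraph

variable {V : Type*}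

/-- The simple graph obtained by forgetting the orientations of the arcs. -/
def gr (H : MixedGraph V) : SimpleGraph V where
  Adj x y := H.edges.Adj x y ∨ (x, y) ∈ H.arcs ∨ (y, x) ∈ H.arcs
  symm := ⟨fun _ _ h => h.imp (fun e => e.symm) Or.symm⟩
  loopless := ⟨fun x h => by
    rcases h with h | h | h
    · exact h.ne rfl
    · exact H.arcs_ne x x h rfl
    · exact H.arcs_ne x x h rfl⟩

/-- The simple graph obtained by removing the arcs. -/
def gr₀ (H : MixedGraph V) : SimpleGraph V := H.edges

/-- There is no sequence `(x₀, …, xₙ)` with `n ≥ 2` and `x₀ = xₙ` whose steps are edges or arcs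
(followed in their direction), at least one of them being an arc. -/
def IsTotallyAcyclic (H : MixedGraph V) : Prop :=
  ¬ ∃ (n : ℕ) (x : Fin (n + 1) → V), 2 ≤ n ∧ x 0 = x (Fin.last n) ∧
    (∀ i : Fin n, H.edges.Adj (x i.castSucc) (x i.succ) ∨ (x i.castSucc, x i.succ) ∈ H.arcs) ∧
    ∃ i : Fin n, (x i.castSucc, x i.succ) ∈ H.arcs

/-- A partial orientation of `G` is a mixed graph that becomes `G` when the orientations of its
arcs are forgotten. -/
def IsPartialOrientation (H : MixedGraph V) (G : SimpleGraph V) : Prop := H.gr = G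

instance [Finite V] : Finite (MixedGraph V) :=
  Finite.of_injective (fun H => (H.edges, H.arcs)) (fun H H' h => by
    simp only [Prod.mk.injEq] at h
    exact MixedGraph.ext h.1 h.2)

/-- The set of totally acyclic partial orientations of `G`. -/
def tacPartialOrientations [Finite V] (G : SimpleGraph V) : Finset (MixedGraph V) :=
  (Set.toFinite {H : MixedGraph V | H.IsPartialOrientation G ∧ H.IsTotallyAcyclic}).toFinset

end MixedGraph

/-- The number of connected components of a graph. -/
def SimpleGraph.cc {V : Type*} (G : SimpleGraph V) : ℕ := Nat.card G.ConnectedComponent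

end

/-! The antipode is the convolution inverse of the identity. For nonempty `V` this gives `∑ I,
S(G|I) * G|Iᶜ = 0`, and `S` of the empty graph is `1`. The term `I = V` is `S(G)` itself, so these
identities determine `S` by induction on the number of vertices. It remains to show that the signed
sum `tacSum` satisfies them too.

Expand `∑ I, tacSum(G|I) * G|Iᶜ` over pairs of a set `I` and a totally acyclic partial orientation
of `G|I`. Keep the edges of `G` outside `I` unoriented and orient those between `I` and `Iᶜ` away
from `I`. This turns the pair into a totally acyclic partial orientation `H` of `G` that is split by
`I`: every arc starts in `I` and no edge crosses `I`. Restriction to `I` is the inverse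
(`sum_tacPartialOrientations_induce`). The product of graphs attached to the pair is `H.gr₀`
(`Splits.ofGraph_restrict_mul`), which no longer depends on `I`.

The coefficient contributed by a fixed `H` is therefore the sum of `(-1) ^ cc` of the edge graph on
`I`, over the sets `I` splitting `H`. By total acyclicity, some component of the edge graph is left
by no arc (`exists_sink`). Adding it to `I`, or removing it, preserves the splitting condition and
changes the number of components by one. This sign-reversing involution makes the coefficient vanish
(`sum_splits_eq_zero`). -/

open Relation

/-! ### Components of the restriction of a graph to a union of components -/

namespace SimpleGraph

variable {V : Type*}

/-- If no edge leaves `I`, the connected components of `L.induce I` are the connected components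
of `L` contained in `I`. -/
theorem cc_induce_eq_ncard {L : SimpleGraph V} {I : Set V}
    (hI : ∀ x y, L.Adj x y → (x ∈ I ↔ y ∈ I)) :
    (L.induce I).cc = {c : L.ConnectedComponent | c.supp ⊆ I}.ncard := by
  -- A walk of `L` that starts in `I` never leaves `I`, hence is a walk of the induced graph.
  have hreach : ∀ x y, L.Reachable x y → ∀ (hx : x ∈ I) (hy : y ∈ I),
      (L.induce I).Reachable ⟨x, hx⟩ ⟨y, hy⟩ := by
    intro x y h
    rw [reachable_iff_reflTransGen] at h
    induction h using ReflTransGen.head_induction_on with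
    | refl => exact fun _ _ => Reachable.refl _
    | head h _ ih =>
      intro hx hy
      have hz := (hI _ _ h).1 hx
      have hadj : (L.induce I).Adj ⟨_, hx⟩ ⟨_, hz⟩ := h
      exact hadj.reachable.trans (ih hz hy)
  have hsub : ∀ x y, L.Reachable x y → x ∈ I → y ∈ I := by
    intro x y h
    rw [reachable_iff_reflTransGen] at h
    induction h with
    | refl => exact id
    | tail _ h ih => exact fun hx => (hI _ _ h).1 (ih hx)
  -- The bijection is the map on components induced by the inclusion of `I`: `hsub` puts its image
  -- in the right set and `hreach` gives injectivity.
  refine Nat.card_congr (Equiv.ofBijective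
    (fun c => ⟨c.map (Embedding.induce I).toHom, ?_⟩) ⟨?_, ?_⟩)
  · induction c using ConnectedComponent.ind with | h v =>
    intro w hw
    exact hsub v w (ConnectedComponent.exact hw).symm v.2
  · intro c d
    induction c, d using ConnectedComponent.ind₂ with | h v w =>
    intro h
    exact ConnectedComponent.sound
      (hreach _ _ (ConnectedComponent.exact (congrArg Subtype.val h)) v.2 w.2)
  · rintro ⟨c, hc⟩
    induction c using ConnectedComponent.ind with | h v =>
    exact ⟨(L.induce I).connectedComponentMk ⟨v, hc rfl⟩, rfl⟩

theorem cc_congr {W : Type*} {L : SimpleGraph V} {M : SimpleGraph W} (e : L ≃g M) :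
    L.cc = M.cc :=
  Nat.card_congr e.connectedComponentEquiv

/-- Adding a connected component to a union of connected components. -/
theorem cc_induce_union_supp [Finite V] {L : SimpleGraph V} {I : Set V}
    (hI : ∀ x y, L.Adj x y → (x ∈ I ↔ y ∈ I)) (c : L.ConnectedComponent)
    (hc : Disjoint I c.supp) : (L.induce (I ∪ c.supp)).cc = (L.induce I).cc + 1 := by
  have hIc : ∀ x y, L.Adj x y → (x ∈ I ∪ c.supp ↔ y ∈ I ∪ c.supp) := fun x y h =>
    or_congr (hI x y h) (c.mem_supp_congr_adj h)
  rw [cc_induce_eq_ncard hI, cc_induce_eq_ncard hIc]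
  have hins : {d : L.ConnectedComponent | d.supp ⊆ I ∪ c.supp} =
      insert c {d : L.ConnectedComponent | d.supp ⊆ I} := by
    ext d
    simp only [Set.mem_ofPred_eq, Set.mem_insert_iff]
    constructor
    · intro h
      by_cases hd : d = c
      · exact Or.inl hd
      · refine Or.inr fun v hv => (h hv).resolve_right fun hv' => hd ?_
        exact ConnectedComponent.eq_of_common_vertex hv hv'
    · rintro (rfl | h)
      · exact Set.subset_union_right
      · exact h.trans Set.subset_union_left
  rw [hins, Set.ncard_insert_of_notMem]
  intro h
  obtain ⟨v, hv⟩ := c.nonempty_supp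
  exact hc.le_bot ⟨h hv, hv⟩

/-- If no edge crosses `I`, the graph is the disjoint union of its restrictions to `I` and to its
complement. -/
def sumInduceComplIso {L : SimpleGraph V} {I : Set V} [DecidablePred (· ∈ I)]
    (hI : ∀ x y, L.Adj x y → (x ∈ I ↔ y ∈ I)) : L.induce I ⊕g L.induce Iᶜ ≃g L where
  toEquiv := Equiv.Set.sumCompl I
  map_rel_iff' := by
    rintro (⟨x, hx⟩ | ⟨x, hx⟩) (⟨y, hy⟩ | ⟨y, hy⟩)
    · simp
    · simpa using fun h => hy ((hI x y h).1 hx)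
    · simpa using fun h => hx ((hI x y h).2 hy)
    · simp

end SimpleGraph

/-! ### Total acyclicity in terms of reachability -/

namespace MixedGraph

variable {V : Type*}

/-- One can go from `x` to `y` along an edge or an arc. -/
def Step (H : MixedGraph V) (x y : V) : Prop := H.edges.Adj x y ∨ (x, y) ∈ H.arcs

/-- With the next lemma, this translates between the indexed sequences that define total acyclicity
and `ReflTransGen`, which is better suited to induction. -/
theorem exists_fin_path_of_reflTransGen {r : V → V → Prop} {a b : V} (h : ReflTransGen r a b) :
    ∃ (n : ℕ) (x : Fin (n + 1) → V), x 0 = a ∧ x (Fin.last n) = b ∧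
      ∀ i : Fin n, r (x i.castSucc) (x i.succ) := by
  induction h using ReflTransGen.head_induction_on with
  | refl => exact ⟨0, fun _ => b, rfl, rfl, fun i => i.elim0⟩
  | @head a c hac _ ih =>
    obtain ⟨n, x, h0, hl, hx⟩ := ih
    refine ⟨n + 1, Fin.cons a x, rfl, ?_, ?_⟩
    · rw [← Fin.succ_last, Fin.cons_succ, hl]
    · intro i
      refine Fin.cases ?_ (fun j => ?_) i
      · simpa [h0] using hac
      · simpa using hx j

theorem reflTransGen_of_fin_path {r : V → V → Prop} {n : ℕ} {x : Fin (n + 1) → V}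
    (hx : ∀ i : Fin n, r (x i.castSucc) (x i.succ)) {i j : Fin (n + 1)} (hij : i ≤ j) :
    ReflTransGen r (x i) (x j) := by
  induction j using Fin.induction with
  | zero => rw [Fin.le_zero_iff.1 hij]
  | succ j ih =>
    rcases hij.eq_or_lt with rfl | h
    · exact .refl
    · exact (ih (Fin.le_castSucc_iff.2 h)).tail (hx j)

/-- A closed sequence containing an arc can be rotated so as to begin with that arc; what remains is
a path from the head of the arc back to its tail. -/
theorem isTotallyAcyclic_iff {H : MixedGraph V} :
    H.IsTotallyAcyclic ↔ ∀ x y, (x, y) ∈ H.arcs → ¬ ReflTransGen H.Step y x := by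
  constructor
  · intro h x y hxy hyx
    obtain ⟨n, p, h0, hl, hp⟩ := exists_fin_path_of_reflTransGen hyx
    -- The return path is nontrivial because an arc has distinct ends; this provides the bound `2 ≤
    -- n + 1` on the length of the cycle.
    have hn : n ≠ 0 := by
      rintro rfl
      exact H.arcs_ne x y hxy (hl.symm.trans h0)
    refine h ⟨n + 1, Fin.cons x p, by omega, ?_, ?_, 0, by simpa [h0] using hxy⟩
    · rw [← Fin.succ_last, Fin.cons_succ, hl, Fin.cons_zero]
    · intro i
      refine Fin.cases ?_ (fun j => ?_) i
      · exact Or.inr (by simpa [h0] using hxy)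
      · simpa [Step] using hp j
  · rintro h ⟨n, p, -, h0, hp, i, hi⟩
    refine h _ _ hi ((reflTransGen_of_fin_path (r := H.Step) hp (Fin.le_last _)).trans ?_)
    rw [← h0]
    exact reflTransGen_of_fin_path (r := H.Step) hp (Fin.zero_le _)

/-! ### Partial orientations split by a set of vertices -/

/-- Every arc starts in `I` and no edge crosses `I`. -/
def Splits (H : MixedGraph V) (I : Set V) : Prop :=
  (∀ x y, (x, y) ∈ H.arcs → x ∈ I) ∧ ∀ x y, H.edges.Adj x y → (x ∈ I ↔ y ∈ I)

/-- The restriction of a mixed graph to a set of vertices. -/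
def restrict (H : MixedGraph V) (I : Set V) : MixedGraph I where
  edges := H.edges.induce I
  arcs := {p | (p.1.1, p.2.1) ∈ H.arcs}
  arcs_ne x y h := fun e => H.arcs_ne x y h (congrArg _ e)
  arcs_asymm x y h := H.arcs_asymm x y h
  edges_disjoint x y h := H.edges_disjoint x y h

/-- The extension of a mixed graph on `I` by the edges of `G` outside `I`, the edges of `G`
leaving `I` being oriented outwards. -/
def extend (G : SimpleGraph V) {I : Set V} (H : MixedGraph I) : MixedGraph V where
  edges :=
    { Adj x y := (∃ (hx : x ∈ I) (hy : y ∈ I), H.edges.Adj ⟨x, hx⟩ ⟨y, hy⟩) ∨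
        x ∉ I ∧ y ∉ I ∧ G.Adj x y
      symm := ⟨by
        rintro x y (⟨hx, hy, h⟩ | ⟨hx, hy, h⟩)
        · exact Or.inl ⟨hy, hx, h.symm⟩
        · exact Or.inr ⟨hy, hx, h.symm⟩⟩
      loopless := ⟨by
        rintro x (⟨hx, hy, h⟩ | ⟨hx, hy, h⟩)
        · exact h.ne rfl
        · exact h.ne rfl⟩ }
  arcs := {p | (∃ (hx : p.1 ∈ I) (hy : p.2 ∈ I), (⟨p.1, hx⟩, ⟨p.2, hy⟩) ∈ H.arcs) ∨
    p.1 ∈ I ∧ p.2 ∉ I ∧ G.Adj p.1 p.2}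
  arcs_ne := by
    rintro x y (⟨hx, hy, h⟩ | ⟨hx, hy, h⟩) rfl
    · exact H.arcs_ne _ _ h rfl
    · exact h.ne rfl
  arcs_asymm := by
    rintro x y (⟨hx, hy, h⟩ | ⟨hx, hy, h⟩) (⟨hx', hy', h'⟩ | ⟨hx', hy', h'⟩)
    · exact H.arcs_asymm _ _ h h'
    · exact hy' hx
    · exact hy hx'
    · exact hy hx'
  edges_disjoint := by
    rintro x y (⟨hx, hy, h⟩ | ⟨hx, hy, h⟩)
    · have := H.edges_disjoint _ _ h
      simp_all
    · simp_all

theorem splits_extend (G : SimpleGraph V) {I : Set V} (H : MixedGraph I) :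
    (extend G H).Splits I := by
  constructor
  · rintro x y (⟨hx, -, -⟩ | ⟨hx, -, -⟩) <;> exact hx
  · rintro x y (⟨hx, hy, -⟩ | ⟨hx, hy, -⟩) <;> simp [hx, hy]

theorem restrict_extend (G : SimpleGraph V) {I : Set V} (H : MixedGraph I) :
    (extend G H).restrict I = H := by
  ext x y
  · simp [restrict, extend]
  · simp [restrict, extend]

/-- Splitting leaves no freedom outside `I`: no arc starts there, so edges of `G` within `Iᶜ` are
unoriented, while an edge of `G` crossing `I` must be an arc, and it must start in `I`. -/
theorem Splits.extend_restrict {G : SimpleGraph V} {H : MixedGraph V} {I : Set V}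
    (hI : H.Splits I) (hG : H.IsPartialOrientation G) : extend G (H.restrict I) = H := by
  obtain rfl : H.gr = G := hG
  obtain ⟨ha, he⟩ := hI
  ext x y
  · have h1 := ha x y
    have h2 := ha y x
    have h3 := he x y
    simp only [extend, restrict, gr, SimpleGraph.comap_adj, Function.Embedding.subtype_apply]
    by_cases hx : x ∈ I <;> by_cases hy : y ∈ I <;> simp_all
  · obtain ⟨x, y⟩ := x
    have h1 := ha x y
    have h2 := ha y x
    have h3 := he x y
    simp only [extend, restrict, gr, Set.mem_ofPred_eq]
    by_cases hx : x ∈ I <;> by_cases hy : y ∈ I <;> simp_all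

theorem IsPartialOrientation.restrict {G : SimpleGraph V} {H : MixedGraph V} (I : Set V)
    (hG : H.IsPartialOrientation G) : (H.restrict I).IsPartialOrientation (G.induce I) := by
  obtain rfl : H.gr = G := hG
  rfl

theorem IsPartialOrientation.extend {G : SimpleGraph V} {I : Set V} {H : MixedGraph I}
    (hG : H.IsPartialOrientation (G.induce I)) : (extend G H).IsPartialOrientation G := by
  ext x y
  have h1 : ∀ (hx : x ∈ I) (hy : y ∈ I), H.gr.Adj ⟨x, hx⟩ ⟨y, hy⟩ ↔ G.Adj x y := fun hx hy => by
    rw [show H.gr = _ from hG]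
    rfl
  simp only [gr, MixedGraph.extend, Set.mem_ofPred_eq] at h1 ⊢
  by_cases hx : x ∈ I <;> by_cases hy : y ∈ I <;> simp_all [G.adj_comm y x]

theorem IsTotallyAcyclic.restrict {H : MixedGraph V} (hH : H.IsTotallyAcyclic) (I : Set V) :
    (H.restrict I).IsTotallyAcyclic := by
  rw [isTotallyAcyclic_iff] at hH ⊢
  exact fun x y hxy h => hH x y hxy (h.lift Subtype.val fun _ _ h => h)

/-- Every arc starts in `I`, and a path ending in `I` stays in `I` when read backwards: no edge
enters `I` from outside, and no arc starts outside. So a cycle through an arc already lies in `I`.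
-/
theorem Splits.isTotallyAcyclic {H : MixedGraph V} {I : Set V} (hI : H.Splits I)
    (hH : (H.restrict I).IsTotallyAcyclic) : H.IsTotallyAcyclic := by
  rw [isTotallyAcyclic_iff] at hH ⊢
  intro x y hxy h
  have hx := hI.1 x y hxy
  have key : ∃ hy : y ∈ I, ReflTransGen (H.restrict I).Step ⟨y, hy⟩ ⟨x, hx⟩ := by
    clear hxy
    induction h using ReflTransGen.head_induction_on with
    | refl => exact ⟨hx, .refl⟩
    | @head a b hab _ ih =>
      obtain ⟨hb, ih⟩ := ih
      have ha : a ∈ I := hab.elim (fun h => (hI.2 a b h).2 hb) (hI.1 a b)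
      exact ⟨ha, .head (show (H.restrict I).Step ⟨a, ha⟩ ⟨b, hb⟩ from hab) ih⟩
  obtain ⟨hy, h⟩ := key
  exact hH ⟨x, hx⟩ ⟨y, hy⟩ hxy h

/-- Totally acyclic partial orientations of `G.induce I` are the restrictions of the totally
acyclic partial orientations of `G` split by `I`. -/
theorem sum_tacPartialOrientations_induce [Finite V] {M : Type*} [AddCommMonoid M]
    (G : SimpleGraph V) (I : Set V) [DecidablePred fun H : MixedGraph V => H.Splits I]
    (f : MixedGraph I → M) :
    ∑ H ∈ tacPartialOrientations (G.induce I), f H =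
      ∑ H ∈ tacPartialOrientations G with H.Splits I, f (H.restrict I) := by
  refine Finset.sum_bij' (fun H _ => extend G H) (fun H _ => H.restrict I) ?_ ?_ ?_ ?_ ?_
  · intro H hH
    simp only [tacPartialOrientations, Set.Finite.mem_toFinset, Finset.mem_filter,
      Set.mem_ofPred_eq] at hH ⊢
    have hs := splits_extend G H
    exact ⟨⟨hH.1.extend, hs.isTotallyAcyclic (by rw [restrict_extend]; exact hH.2)⟩, hs⟩
  · intro H hH
    simp only [tacPartialOrientations, Set.Finite.mem_toFinset, Finset.mem_filter,
      Set.mem_ofPred_eq] at hH ⊢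
    exact ⟨hH.1.1.restrict I, hH.1.2.restrict I⟩
  · exact fun H _ => restrict_extend G H
  · intro H hH
    simp only [tacPartialOrientations, Set.Finite.mem_toFinset, Finset.mem_filter,
      Set.mem_ofPred_eq] at hH
    exact hH.2.extend_restrict hH.1.1
  · exact fun H _ => by rw [restrict_extend]

/-! ### Sink components and the cancellation of signs -/

/-- A nonempty totally acyclic mixed graph has a component of unoriented edges that no arc
leaves. -/
theorem IsTotallyAcyclic.exists_sink [Finite V] [Nonempty V] {H : MixedGraph V}
    (hH : H.IsTotallyAcyclic) :
    ∃ c : H.edges.ConnectedComponent, ∀ x y, (x, y) ∈ H.arcs → x ∉ c.supp := by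
  rw [isTotallyAcyclic_iff] at hH
  have hstep : ∀ x y, H.edges.Reachable x y → ReflTransGen H.Step x y := fun x y h =>
    ReflTransGen.mono (fun _ _ h => Or.inl h) _ _ ((SimpleGraph.reachable_iff_reflTransGen x y).1 h)
  -- `x` strictly precedes `y` if some path from `x` to `y` follows an arc
  let r : V → V → Prop := fun y x =>
    ∃ a b, ReflTransGen H.Step x a ∧ (a, b) ∈ H.arcs ∧ ReflTransGen H.Step b y
  have : IsTrans V r := ⟨fun z y x ⟨a, b, h1, h2, h3⟩ ⟨c, d, h4, h5, h6⟩ =>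
    ⟨a, b, (h4.trans (.head (Or.inr h5) h6)).trans h1, h2, h3⟩⟩
  have : Std.Irrefl r := ⟨fun x ⟨a, b, h1, h2, h3⟩ => hH a b h2 (h3.trans h1)⟩
  -- As `r` reverses the order of paths, a minimal `x` is a vertex from which no path follows an
  -- arc.
  obtain ⟨x, -, hx⟩ := (Finite.wellFounded_of_trans_of_irrefl r).has_min Set.univ Set.univ_nonempty
  refine ⟨H.edges.connectedComponentMk x, fun a b hab ha => hx b trivial ?_⟩
  exact ⟨a, b, hstep x a (SimpleGraph.ConnectedComponent.exact ha).symm, hab, .refl⟩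

/-- Tails of arcs lie in `I` and outside the component, so toggling the component keeps them; and a
whole component is toggled, so no edge becomes a crossing one. -/
theorem Splits.symmDiff_supp {H : MixedGraph V} {I : Set V} (hI : H.Splits I)
    {c : H.edges.ConnectedComponent} (hc : ∀ x y, (x, y) ∈ H.arcs → x ∉ c.supp) :
    H.Splits (symmDiff I c.supp) := by
  constructor
  · exact fun x y h => Or.inl ⟨hI.1 x y h, hc x y h⟩
  · intro x y h
    simp only [Set.mem_symmDiff, hI.2 x y h, c.mem_supp_congr_adj h]

/-- Since no edge crosses `I`, the component is either contained in `I` or disjoint from it.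
Toggling it removes or adds exactly one component. -/
theorem neg_one_pow_cc_induce_symmDiff [Finite V] {R : Type*} [Ring R] {L : SimpleGraph V}
    {I : Set V} (hI : ∀ x y, L.Adj x y → (x ∈ I ↔ y ∈ I)) (c : L.ConnectedComponent) :
    (-1 : R) ^ (L.induce I).cc + (-1 : R) ^ (L.induce (symmDiff I c.supp)).cc = 0 := by
  by_cases hc : c.supp ⊆ I
  · have hd : Disjoint (symmDiff I c.supp) c.supp := by
      rw [symmDiff_of_ge hc]
      exact Set.disjoint_sdiff_left
    have hI' : ∀ x y, L.Adj x y → (x ∈ symmDiff I c.supp ↔ y ∈ symmDiff I c.supp) := by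
      intro x y h
      simp only [Set.mem_symmDiff, hI x y h, c.mem_supp_congr_adj h]
    have hu : symmDiff I c.supp ∪ c.supp = I := by
      rw [symmDiff_of_ge hc]
      exact Set.sdiff_union_of_subset hc
    have := SimpleGraph.cc_induce_union_supp hI' c hd
    rw [hu] at this
    rw [this, pow_succ]
    simp
  · have hd : Disjoint I c.supp := by
      rw [Set.disjoint_left]
      intro v hv hvc
      refine hc fun w hw => ?_
      have h := SimpleGraph.ConnectedComponent.exact (hvc.trans hw.symm)
      rw [SimpleGraph.reachable_iff_reflTransGen] at h
      clear hw
      induction h with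
      | refl => exact hv
      | tail _ h ih => exact (hI _ _ h).1 ih
    have hu : symmDiff I c.supp = I ∪ c.supp := hd.symmDiff_eq_sup
    rw [hu, SimpleGraph.cc_induce_union_supp hI c hd, pow_succ]
    simp

/-- The signs attached to the sets splitting a totally acyclic mixed graph cancel. -/
theorem IsTotallyAcyclic.sum_splits_eq_zero [Fintype V] [Nonempty V] {R : Type*} [Ring R]
    [Fintype (Set V)] {H : MixedGraph V} (hH : H.IsTotallyAcyclic)
    [DecidablePred fun I : Set V => H.Splits I] :
    ∑ I : Set V with H.Splits I, (-1 : R) ^ (H.restrict I).gr₀.cc = 0 := by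
  obtain ⟨c, hc⟩ := hH.exists_sink
  -- The component `c` depends on `H` only, not on `I`, so toggling it twice restores `I`; it is
  -- nonempty, so no `I` is fixed.
  refine Finset.sum_involution (fun I _ => symmDiff I c.supp) ?_ ?_ ?_ ?_
  · intro I hI
    exact neg_one_pow_cc_induce_symmDiff (Finset.mem_filter.1 hI).2.2 c
  · intro I _ _ h
    rw [symmDiff_eq_left] at h
    exact c.nonempty_supp.ne_empty h
  · intro I hI
    simp only [Finset.mem_filter, Finset.mem_univ, true_and] at hI ⊢
    exact hI.symmDiff_supp hc
  · exact fun I _ => symmDiff_symmDiff_cancel_right _ _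

end MixedGraph

/-! ### The common recursion of the antipode and the signed sum -/

namespace GraphAlgebra

open MixedGraph

variable (K : Type*) [CommRing K]

/-- The signed sum over the totally acyclic partial orientations of `G` of their graphs of
unoriented edges. -/
noncomputable def tacSum {V : Type*} [Finite V] (G : SimpleGraph V) : GraphAlgebra K :=
  ∑ H ∈ tacPartialOrientations G, (-1 : K) ^ H.gr₀.cc • ofGraph K H.gr₀

/-- No arc has both ends outside `I`, so `G` and `H.gr₀` agree on `Iᶜ`; and no edge of `H.gr₀`
crosses `I`, so it is the disjoint union of its two restrictions. -/
theorem Splits.ofGraph_restrict_mul {V : Type*} [Finite V] {G : SimpleGraph V} {H : MixedGraph V}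
    {I : Set V} (hI : H.Splits I) (hG : H.IsPartialOrientation G) :
    ofGraph K (H.restrict I).gr₀ * ofGraph K (G.induce Iᶜ) = ofGraph K H.gr₀ := by
  classical
  have h : G.induce Iᶜ = H.gr₀.induce Iᶜ := by
    obtain rfl : H.gr = G := hG
    ext x y
    simpa [gr, gr₀] using fun h => h.elim (fun h => (x.2 (hI.1 _ _ h)).elim)
      (fun h => (y.2 (hI.1 _ _ h)).elim)
  rw [h, ofGraph_mul]
  exact ofGraph_congr K (SimpleGraph.sumInduceComplIso hI.2)

theorem sum_tacSum_mul {V : Type*} [Fintype V] [Nonempty V] [Fintype (Set V)]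
    (G : SimpleGraph V) :
    ∑ I : Set V, tacSum K (G.induce I) * ofGraph K (G.induce Iᶜ) = 0 := by
  classical
  -- The splitting condition is written as an `if`, so that the range of `H` is independent of `I`
  -- and the two sums can be exchanged.
  have h : ∀ I : Set V, tacSum K (G.induce I) * ofGraph K (G.induce Iᶜ) =
      ∑ H ∈ tacPartialOrientations G, if H.Splits I then
        (-1 : K) ^ (H.restrict I).gr₀.cc • ofGraph K H.gr₀ else 0 := by
    intro I
    rw [tacSum, sum_tacPartialOrientations_induce, Finset.sum_mul, ← Finset.sum_filter]
    refine Finset.sum_congr rfl fun H hH => ?_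
    simp only [tacPartialOrientations, Set.Finite.mem_toFinset, Finset.mem_filter,
      Set.mem_ofPred_eq] at hH
    rw [smul_mul_assoc, Splits.ofGraph_restrict_mul K hH.2 hH.1.1]
  rw [Finset.sum_congr rfl fun I _ => h I, Finset.sum_comm]
  refine Finset.sum_eq_zero fun H hH => ?_
  simp only [tacPartialOrientations, Set.Finite.mem_toFinset, Set.mem_ofPred_eq] at hH
  rw [← Finset.sum_filter, ← Finset.sum_smul, hH.2.sum_splits_eq_zero, zero_smul]

/-- The top term of the recursion lives on the subtype `Set.univ` rather than on `V`. Every mixed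
graph is split by `Set.univ`, so the bijection by restriction identifies the two sums. -/
theorem tacSum_induce_univ {V : Type*} [Finite V] (G : SimpleGraph V) :
    tacSum K (G.induce Set.univ) = tacSum K G := by
  classical
  rw [tacSum, sum_tacPartialOrientations_induce, tacSum, Finset.filter_true_of_mem]
  · refine Finset.sum_congr rfl fun H _ => ?_
    let e : (H.restrict Set.univ).gr₀ ≃g H.gr₀ := SimpleGraph.induceUnivIso H.gr₀
    rw [ofGraph_congr K e, SimpleGraph.cc_congr e]
  · exact fun H _ => ⟨fun _ _ _ => trivial, fun _ _ _ => Iff.rfl⟩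

theorem tacSum_of_isEmpty {V : Type*} [Finite V] [IsEmpty V] (G : SimpleGraph V) :
    tacSum K G = 1 := by
  have hu : ∀ H H' : MixedGraph V, H = H' := fun H H' => by
    ext x
    · exact isEmptyElim x
    · exact isEmptyElim x.1
  let H₀ : MixedGraph V := ⟨G, ∅, by simp, by simp, by simp⟩
  have h : tacPartialOrientations G = {H₀} := by
    ext H
    simp only [tacPartialOrientations, Set.Finite.mem_toFinset, Set.mem_ofPred_eq,
      Finset.mem_singleton, hu H H₀, iff_true]
    exact ⟨Subsingleton.elim _ _, isTotallyAcyclic_iff.2 fun x => isEmptyElim x⟩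
  have hcc : H₀.gr₀.cc = 0 := by
    have : IsEmpty H₀.gr₀.ConnectedComponent := ⟨fun c => c.ind fun v => isEmptyElim v⟩
    exact Nat.card_of_isEmpty
  rw [tacSum, h, Finset.sum_singleton, hcc, pow_zero, one_smul, ofGraph_of_isEmpty]

theorem sum_antipode_mul {V : Type*} [Fintype V] [Nonempty V] [Fintype (Set V)]
    (G : SimpleGraph V) :
    ∑ I : Set V, HopfAlgebra.antipode K (ofGraph K (G.induce I)) * ofGraph K (G.induce Iᶜ) =
      0 := by
  have h := HopfAlgebra.mul_antipode_rTensor_comul_apply (R := K) (ofGraph K G)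
  rw [comul_ofGraph, counit_ofGraph, if_neg (not_isEmpty_of_nonempty V), map_zero] at h
  simp only [map_sum, LinearMap.rTensor_tmul, LinearMap.mul'_apply] at h
  rw [← h]
  -- The two sums differ at most in their `Fintype (Set V)` instances.
  congr!

/-- Both sides satisfy the same recursion, in which every term with `I ≠ Set.univ` involves a graph
with fewer vertices. -/
theorem antipode_ofGraph {V : Type*} [Finite V] (G : SimpleGraph V) :
    HopfAlgebra.antipode K (ofGraph K G) = tacSum K G := by
  classical
  induction hn : Nat.card V using Nat.strong_induction_on generalizing V with | h n ih =>
  subst hn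
  cases nonempty_fintype V
  cases isEmpty_or_nonempty V
  · rw [tacSum_of_isEmpty, ofGraph_of_isEmpty, HopfAlgebra.antipode_one]
  have h := (sum_antipode_mul K G).trans (sum_tacSum_mul K G).symm
  -- The term `I = Set.univ` is isolated: its second factor is the empty graph, that is `1`, and the
  -- other terms agree by induction.
  rw [Fintype.sum_eq_add_sum_compl Set.univ, Fintype.sum_eq_add_sum_compl Set.univ] at h
  have hrest : ∀ I ∈ ({Set.univ}ᶜ : Finset (Set V)),
      HopfAlgebra.antipode K (ofGraph K (G.induce I)) * ofGraph K (G.induce Iᶜ) =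
        tacSum K (G.induce I) * ofGraph K (G.induce Iᶜ) := by
    intro I hI
    rw [ih (Nat.card I) ?_ (G.induce I) rfl]
    refine lt_of_lt_of_eq ?_ (Set.ncard_univ V)
    exact Set.ncard_lt_ncard (Set.ssubset_univ_iff.2 (by simpa using hI))
  rw [Finset.sum_congr rfl hrest, add_left_inj] at h
  have : IsEmpty ↥((Set.univ : Set V)ᶜ) := by
    rw [Set.compl_univ]
    infer_instance
  rwa [ofGraph_of_isEmpty K (G.induce Set.univᶜ), mul_one, mul_one,
    ofGraph_congr K (SimpleGraph.induceUnivIso G),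
    tacSum_induce_univ] at h

end GraphAlgebra

theorem mainTheorem1 {K : Type*} [Field K] [CharZero K] {V : Type*} [Finite V]
    (G : SimpleGraph V) :
    HopfAlgebra.antipode K (GraphAlgebra.ofGraph K G) =
      ∑ H ∈ MixedGraph.tacPartialOrientations G,
        (-1 : K) ^ H.gr₀.cc • GraphAlgebra.ofGraph K H.gr₀ :=
  GraphAlgebra.antipode_ofGraph K G
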